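/- Setting. Let $u>0$, $T=[0,u]$, $d\in\mathbb N$, let $(\Omega,\mathcal F,(\mathcal F_t)_{t\in T},\mathbb P)$ be a filtered probability space such that every $\mathcal F_t$ contains all $\mathbb P$-null sets of $\mathcal F$, and let $M=(M_t)_{t\in T}$ be an adapted $\mathbb R^d$-valued continuous local martingale with $M_0=0$. Assume that its matrix-valued covariation process $[M]=([M^i,M^j])_{i,j\le d}$ is, up to indistinguishability, deterministic, and that $\operatorname{trace}([M]_u)>0$. Let $\mu$ be a finite Borel measure on $T$ and $\pi$ a measurable function on $T$ with values in the symmetric matrices in $\mathbb R^{d\times d}$ and entries in $L^1(\mu)$, such that $[M]_t=\int_{[0,t]}\pi\,\mathrm d\mu$ entrywise for all $t\in T$ (for example, $\mu$ the Lebesgue–Stieltjes measure of $\operatorname{trace}([M])$ and $\pi_{i,j}=\mathrm d\mu_{i,j}/\mathrm d\mu$, where $\mu_{i,j}$ is the signed measure induced by $[M^i,M^j]$); then $\pi$ is positive semidefinite $\mu$-a.e. Put $\mu_{i,i}=\pi_{i,i}\cdot\mu$. For measurable $f\colon T\to\mathbb R^d$ let $$\|f\|_{\Lambda^2}=\Bigl(\int_T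 f^\top(s)\pi(s)f(s)\,\mu(\mathrm ds)\Bigr)^{1/2},$$ let $\Lambda^2$ be the set of all measurable $f\colon T\to\mathbb R^d$ with $\|f\|_{\Lambda^2}<\infty$, and let $\Lambda^{2,0}\subset\Lambda^2$ be the set of all measurable $f=(f_1,\dots,f_d)\colon T\to\mathbb R^d$ with $f_i\in L^2(\mu_{i,i})$ for every $i$; functions $f,g$ with $(f-g)^\top\pi(f-g)=0$ $\mu$-a.e. are identified, and $\Lambda^{2,0}$ carries the norm $\|\cdot\|_{\Lambda^2}$. For $\psi\colon\mathbb R\to\mathbb R$ let $\mathcal{NN}^d_{1,\infty}(\psi)$ be the set of (restrictions to $T$ of) feedforward neural networks with one input neuron, one hidden layer with an arbitrary finite number of nodes with activation function $\psi$, and $d$ output neurons with identity activation, i.e. of all functions $t\mapsto b+\sum_{j=1}^{n}c_j\,\psi(\alpha_j t+\eta_j)$ with $n\in\mathbb N$, $\alpha_j,\eta_j\in\mathbb R$, $b,c_j\in\mathbb R^d$. Proposition. If $\psi\colon\mathbb R\to\mathbb R$ is bounded, Borel measurable and not Lebesgue-almost everywhere equal to a constant, then $\mathcal{NN}^d_{1,\infty}(\psi)$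 is a dense linear subspace of $\Lambda^{2,0}$: it is a linear subspace contained in $\Lambda^{2,0}$, and for all $f\in\Lambda^{2,0}$ and $\varepsilon>0$ there is $g\in\mathcal{NN}^d_{1,\infty}(\psi)$ with $\|f-g\|_{\Lambda^2}<\varepsilon$. -/

import Mathlib

open MeasureTheory ProbabilityTheory

/-- The time interval `T = [0, u]`, with the order, topology and Borel structure of a subtype. -/
abbrev TimeInterval (u : ℝ) : Type := Set.Icc (0 : ℝ) u

instance TimeInterval.instNonempty (u : ℝ) [hu : Fact (0 < u)] : Nonempty (TimeInterval u) :=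
  ⟨⟨0, le_refl 0, hu.out.le⟩⟩

/-! ### Continuous local martingales and their covariation -/

section Processes

variable {Ω : Type*} [mΩ : MeasurableSpace Ω] {u : ℝ} [Fact (0 < u)]

/-- Local martingale on `[0, u]`, for processes that vanish at time `0`: some localizing sequence of
stopping times turns the process into a martingale. Stopping times take values in
`[0, u] ∪ {⊤}`, where `⊤` is isolated, so almost surely `τ n = ⊤` for all large `n`. -/
def IsLocalMartingale (ℱ : Filtration (TimeInterval u) mΩ) (P : Measure Ω)
    (X : TimeInterval u → Ω → ℝ) : Prop :=
  ∃ τ : ℕ → Ω → WithTop (TimeInterval u),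
    IsLocalizingSequence ℱ τ P ∧ ∀ n, Martingale (stoppedProcess X (τ n)) ℱ P

/-- Real-valued, adapted, continuous local martingale on `[0, u]`, started at `0`. -/
structure IsContinuousLocalMartingale (ℱ : Filtration (TimeInterval u) mΩ) (P : Measure Ω)
    (X : TimeInterval u → Ω → ℝ) : Prop where
  adapted : StronglyAdapted ℱ X
  continuous_paths : ∀ᵐ ω ∂P, Continuous fun t => X t ω
  zero_at_zero : ∀ᵐ ω ∂P, ∀ t : TimeInterval u, (t : ℝ) = 0 → X t ω = 0
  localMartingale : IsLocalMartingale ℱ P X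

/-- `V` is (a version of) the covariation process `[X, Y]`: the continuous process such that, for each
`t`, the sums of products of increments of `X` and `Y` along any sequence of partitions
`0 = p n 0 ≤ p n 1 ≤ ⋯ ≤ p n (K n) = t` with mesh tending to `0` converge to `V t` in probability. -/
structure IsCovariation (P : Measure Ω) (X Y V : TimeInterval u → Ω → ℝ) : Prop where
  continuous_paths : ∀ᵐ ω ∂P, Continuous fun t => V t ω
  tendsto_sums : ∀ (t : TimeInterval u) (K : ℕ → ℕ) (p : ℕ → ℕ → TimeInterval u),
    (∀ n, Monotone (p n)) → (∀ n, (p n 0 : ℝ) = 0) → (∀ n, p n (K n) = t) →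
    (∀ ε > (0 : ℝ), ∀ᶠ n in Filter.atTop, ∀ k < K n, (p n (k + 1) : ℝ) - (p n k : ℝ) < ε) →
    TendstoInMeasure P
      (fun n ω => ∑ k ∈ Finset.range (K n),
        (X (p n (k + 1)) ω - X (p n k) ω) * (Y (p n (k + 1)) ω - Y (p n k) ω))
      Filter.atTop (V t)

end Processes

/-! ### The weighted spaces -/

section Spaces

variable {u : ℝ} {d : ℕ}

/-- The pair `(π, μ)` represents the matrix-valued function `A` on `[0, u]`: `π` is a measurable,
symmetric-matrix-valued function with entries in `L¹(μ)`, and `A(t) = ∫_{[0,t]} π dμ` entrywise. -/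
structure IsRepresentation (A π : TimeInterval u → Matrix (Fin d) (Fin d) ℝ)
    (μ : Measure (TimeInterval u)) : Prop where
  measurable : ∀ i j, Measurable fun s => π s i j
  symm : ∀ s, (π s).IsSymm
  integrable : ∀ i j, Integrable (fun s => π s i j) μ
  eq_integral : ∀ t i j, A t i j = ∫ s in Set.Iic t, π s i j ∂μ

/-- The integrand `s ↦ f(s)ᵀ π(s) f(s)`. -/
def quadForm (π : TimeInterval u → Matrix (Fin d) (Fin d) ℝ) (f : TimeInterval u → Fin d → ℝ) :
    TimeInterval u → ℝ :=
  fun s => f s ⬝ᵥ (π s).mulVec (f s)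

/-- `Λ²`: the measurable `f : [0, u] → ℝᵈ` with `∫ fᵀ π f dμ < ∞`. -/
def Lambda2 (π : TimeInterval u → Matrix (Fin d) (Fin d) ℝ) (μ : Measure (TimeInterval u)) :
    Set (TimeInterval u → Fin d → ℝ) :=
  {f | Measurable f ∧ Integrable (quadForm π f) μ}

/-- `‖f‖_{Λ²} = (∫ fᵀ π f dμ)^{1/2}`, a seminorm on functions; it is the norm once `f` and `g` with
`(f - g)ᵀ π (f - g) = 0` `μ`-a.e. are identified. -/
noncomputable def lambdaNorm (π : TimeInterval u → Matrix (Fin d) (Fin d) ℝ)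
    (μ : Measure (TimeInterval u)) (f : TimeInterval u → Fin d → ℝ) : ℝ :=
  Real.sqrt (∫ s, quadForm π f s ∂μ)

/-- The measure `μ_{i,i} = π_{i,i} · μ` (the Lebesgue–Stieltjes measure of `[Mⁱ]`). -/
noncomputable def diagMeasure (π : TimeInterval u → Matrix (Fin d) (Fin d) ℝ)
    (μ : Measure (TimeInterval u)) (i : Fin d) : Measure (TimeInterval u) :=
  μ.withDensity fun s => ENNReal.ofReal (π s i i)

/-- `Λ^{2,0}`: the measurable `f : [0, u] → ℝᵈ` with `f_i ∈ L²(μ_{i,i})` for every `i`. -/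
noncomputable def Lambda20 (π : TimeInterval u → Matrix (Fin d) (Fin d) ℝ)
    (μ : Measure (TimeInterval u)) : Submodule ℝ (TimeInterval u → Fin d → ℝ) where
  carrier := {f | Measurable f ∧ ∀ i, MemLp (fun s => f s i) 2 (diagMeasure π μ i)}
  add_mem' hf hg := ⟨hf.1.add hg.1, fun i => (hf.2 i).add (hg.2 i)⟩
  zero_mem' := ⟨measurable_const, fun _ => MemLp.zero⟩
  smul_mem' c _ hf := ⟨hf.1.const_smul c, fun i => (hf.2 i).const_smul c⟩

end Spaces

/-! ### Feedforward neural networks -/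

/-- `IsHiddenLayer ψ l k n h`: the function `h : ℝ → ℝⁿ` is the output of the `k`-th layer of a
feedforward network with one input neuron (layer `0`), in which each of the layers `1, …, k` has at
most `l` nodes, every node applying `ψ` to an affine function of the preceding layer. -/
inductive IsHiddenLayer (ψ : ℝ → ℝ) (l : ℕ∞) : ℕ → (n : ℕ) → (ℝ → Fin n → ℝ) → Prop
  | input : IsHiddenLayer ψ l 0 1 (fun t _ => t)
  | step {k n : ℕ} {h : ℝ → Fin n → ℝ} (hh : IsHiddenLayer ψ l k n h) (m : ℕ) (hm : (m : ℕ∞) ≤ l)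
      (W : Matrix (Fin m) (Fin n) ℝ) (b : Fin m → ℝ) :
      IsHiddenLayer ψ l (k + 1) m (fun t j => ψ (W.mulVec (h t) j + b j))

/-- `NN_{k,l}^d(ψ)`: feedforward networks `ℝ → ℝᵈ` with `k` hidden layers of at most `l` nodes each
(`l = ⊤`: arbitrarily many), activation `ψ`, and `d` affine output neurons. -/
def NN (ψ : ℝ → ℝ) (k : ℕ) (l : ℕ∞) (d : ℕ) : Set (ℝ → Fin d → ℝ) :=
  {f | ∃ (n : ℕ) (h : ℝ → Fin n → ℝ), IsHiddenLayer ψ l k n h ∧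
    ∃ (W : Matrix (Fin d) (Fin n) ℝ) (b : Fin d → ℝ), f = fun t => W.mulVec (h t) + b}

/-- The networks in `NN_{k,l}^d(ψ)` as functions on `[0, u]`. -/
def NNOn (u : ℝ) (ψ : ℝ → ℝ) (k : ℕ) (l : ℕ∞) (d : ℕ) : Set (TimeInterval u → Fin d → ℝ) :=
  {g | ∃ f ∈ NN ψ k l d, ∀ t : TimeInterval u, g t = f t}

/-! The scalar case is a Hilbert space argument. Let `F` in `L²(ν)`, with `ν` a finite measure on
`[0, u]`, be orthogonal to every neuron `t ↦ ψ(at + η)`. Averaging over `η` replaces `ψ` by a smooth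
mollification `w ⋆ ψ`. Differentiating `k` times in `a` and putting `a = 0` gives `(w ⋆ ψ)^{(k)}(η)
· ∫ F(t) t^k dν = 0` (`integral_mul_pow_eq_zero`). For each `k` some `w` and `η` make the first
factor nonzero: otherwise every `w ⋆ ψ` would be a bounded polynomial, hence constant, and `ψ` would
be constant almost everywhere (`exists_mollify_iterate_deriv_ne_zero`). So `F` annihilates all
monomials, and `F = 0` by Weierstrass.

The vector case reduces to this because `π` is positive semidefinite `μ`-a.e.
(`ae_quadraticForm_nonneg`): the approximating sums for the quadratic variation of `x · M` are sums
of squares, so `xᵀ A x` is nondecreasing and its density is nonnegative. Then `fᵀ π f ≤ d ∑ π_{i,i}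
f_i²`, so the `Λ²` norm is controlled by the norms of the coordinates in `L²(μ_{i,i})`. The
coordinates can be approximated separately, since hidden nodes of different networks may be placed
side by side. -/

/-! ### Mollification of a bounded activation function -/

section Mollification

open scoped Convolution ContDiff

/-- The mollification `x ↦ ∫ w(y) ψ(x - y) dy`. -/
noncomputable def mollify (ψ w : ℝ → ℝ) : ℝ → ℝ :=
  w ⋆[ContinuousLinearMap.lsmul ℝ ℝ, volume] ψ

theorem mollify_apply (ψ w : ℝ → ℝ) (x : ℝ) : mollify ψ w x = ∫ y, w y * ψ (x - y) := rfl

theorem locallyIntegrable_of_bounded {ψ : ℝ → ℝ} {C : ℝ} (hC : ∀ x, |ψ x| ≤ C)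
    (hψ : Measurable ψ) : LocallyIntegrable ψ volume := by
  refine (locallyIntegrable_const C).mono hψ.aestronglyMeasurable (ae_of_all _ fun x => ?_)
  rw [Real.norm_eq_abs]
  exact (hC x).trans (le_abs_self C)

theorem abs_mollify_le {ψ w : ℝ → ℝ} {C : ℝ} (hC : ∀ x, |ψ x| ≤ C) (hw : Integrable w) (x : ℝ) :
    |mollify ψ w x| ≤ ∫ y, |w y| * C := by
  rw [mollify_apply, ← Real.norm_eq_abs]
  refine norm_integral_le_of_norm_le (hw.abs.mul_const C) (ae_of_all _ fun y => ?_)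
  rw [norm_mul, Real.norm_eq_abs, Real.norm_eq_abs]
  exact mul_le_mul_of_nonneg_left (hC _) (abs_nonneg _)

/-- Smooth compactly supported functions on the line. -/
def IsTestFunction (w : ℝ → ℝ) : Prop := ContDiff ℝ ∞ w ∧ HasCompactSupport w

theorem IsTestFunction.deriv {w : ℝ → ℝ} (hw : IsTestFunction w) : IsTestFunction (deriv w) :=
  ⟨(contDiff_infty_iff_deriv.1 hw.1).2, hw.2.deriv⟩

theorem IsTestFunction.iterate_deriv {w : ℝ → ℝ} (hw : IsTestFunction w) (k : ℕ) :
    IsTestFunction (_root_.deriv^[k] w) := by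
  induction k with
  | zero => exact hw
  | succ k ih =>
    rw [Function.iterate_succ_apply']
    exact ih.deriv

theorem IsTestFunction.integrable {w : ℝ → ℝ} (hw : IsTestFunction w) : Integrable w :=
  hw.1.continuous.integrable_of_hasCompactSupport hw.2

theorem hasDerivAt_mollify {ψ w : ℝ → ℝ} (hψ : LocallyIntegrable ψ volume)
    (hw : IsTestFunction w) (x : ℝ) :
    HasDerivAt (mollify ψ w) (mollify ψ (deriv w) x) x :=
  hw.2.hasDerivAt_convolution_left (ContinuousLinearMap.lsmul ℝ ℝ)
    (hw.1.of_le (by exact_mod_cast le_top)) hψ x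

theorem continuous_mollify {ψ w : ℝ → ℝ} (hψ : LocallyIntegrable ψ volume)
    (hw : IsTestFunction w) : Continuous (mollify ψ w) :=
  continuous_iff_continuousAt.2 fun x => (hasDerivAt_mollify hψ hw x).continuousAt

/-- A bounded function with constant derivative has zero derivative. -/
theorem eq_zero_of_hasDerivAt_const_of_bounded {g : ℝ → ℝ} {c B : ℝ}
    (hg : ∀ x, HasDerivAt g c x) (hB : ∀ x, |g x| ≤ B) : c = 0 := by
  have hconst : ∀ x, g x - c * x = g 0 - c * 0 := fun x =>
    is_const_of_deriv_eq_zero (f := fun x => g x - c * x)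
      (fun x => ((hg x).sub ((hasDerivAt_id x).const_mul c)).differentiableAt)
      (fun x => ((hg x).sub ((hasDerivAt_id x).const_mul c)).deriv.trans (by simp)) x 0
  by_contra hc
  have h1 := hconst ((2 * B + 1) / c)
  rw [mul_div_cancel₀ _ hc] at h1
  have h2 := abs_le.1 (hB ((2 * B + 1) / c))
  have h3 := abs_le.1 (hB 0)
  linarith

theorem const_of_mollify_deriv_eq_zero {ψ w : ℝ → ℝ} (hψ : LocallyIntegrable ψ volume)
    (hw : IsTestFunction w) (h : ∀ x, mollify ψ (deriv w) x = 0) (x y : ℝ) :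
    mollify ψ w x = mollify ψ w y :=
  is_const_of_deriv_eq_zero (fun x => (hasDerivAt_mollify hψ hw x).differentiableAt)
    (fun x => (hasDerivAt_mollify hψ hw x).deriv.trans (h x)) x y

/-- Every derivative of a mollification is again a mollification, hence bounded. If the derivative
of order `k + 2` vanishes, that of order `k + 1` is constant and is the derivative of a bounded
function, hence zero; so the order descends to one. -/
theorem mollify_deriv_eq_zero_of_iterate {ψ : ℝ → ℝ} {C : ℝ} (hC : ∀ x, |ψ x| ≤ C)
    (hψ : Measurable ψ) (k : ℕ)
    (h : ∀ w, IsTestFunction w → ∀ x, mollify ψ (deriv^[k] w) x = 0) :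
    ∀ w, IsTestFunction w → ∀ x, mollify ψ (deriv w) x = 0 := by
  have hloc := locallyIntegrable_of_bounded hC hψ
  induction k with
  | zero => exact fun w hw => h _ hw.deriv
  | succ k ih =>
    rcases k with _ | k
    · exact h
    refine ih fun w hw x => ?_
    have hk := hw.iterate_deriv k
    rw [Function.iterate_succ_apply']
    refine eq_zero_of_hasDerivAt_const_of_bounded (g := mollify ψ (deriv^[k] w)) (fun y => ?_)
      (abs_mollify_le hC hk.integrable)
    rw [const_of_mollify_deriv_eq_zero hloc hk.deriv (fun z => ?_) x y]
    · exact hasDerivAt_mollify hloc hk y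
    · have := h w hw z
      rwa [Function.iterate_succ_apply', Function.iterate_succ_apply'] at this

/-- A bounded function all of whose mollifications are constant is almost everywhere constant. -/
theorem ae_const_of_mollify_const {ψ : ℝ → ℝ} (hloc : LocallyIntegrable ψ volume)
    (h : ∀ w, IsTestFunction w → ∀ x y, mollify ψ w x = mollify ψ w y) :
    ∃ c, ∀ᵐ x ∂(volume : Measure ℝ), ψ x = c := by
  -- The ratio of outer to inner radius stays at 2; a bounded ratio is what almost everywhere
  -- convergence of the convolutions needs.
  let φ : ℕ → ContDiffBump (0 : ℝ) := fun n =>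
    ⟨1 / ((n : ℝ) + 1), 2 * (1 / ((n : ℝ) + 1)), by positivity, by
      have : (0 : ℝ) < 1 / ((n : ℝ) + 1) := by positivity
      linarith⟩
  have hφ : Filter.Tendsto (fun n => (φ n).rOut) Filter.atTop (nhds 0) := by
    have := (tendsto_one_div_add_atTop_nhds_zero_nat (𝕜 := ℝ)).const_mul 2
    rwa [mul_zero] at this
  have hae := ContDiffBump.ae_convolution_tendsto_right_of_locallyIntegrable (K := 2) hφ
    (Filter.Eventually.of_forall fun n => le_rfl) hloc
  obtain ⟨x₀, hx₀⟩ := hae.exists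
  refine ⟨ψ x₀, ?_⟩
  filter_upwards [hae] with x hx
  refine tendsto_nhds_unique hx (hx₀.congr fun n => ?_)
  exact h _ ⟨(φ n).contDiff_normed, (φ n).hasCompactSupport_normed⟩ x₀ x

/-- If `ψ` is bounded and not almost everywhere constant, then some mollification of `ψ` has a
`k`-th derivative that does not vanish identically. -/
theorem exists_mollify_iterate_deriv_ne_zero {ψ : ℝ → ℝ} {C : ℝ} (hC : ∀ x, |ψ x| ≤ C)
    (hψ : Measurable ψ) (hnc : ¬ ∃ c, ∀ᵐ x ∂(volume : Measure ℝ), ψ x = c) (k : ℕ) :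
    ∃ w, IsTestFunction w ∧ ∃ x, mollify ψ (deriv^[k] w) x ≠ 0 := by
  by_contra! h
  have hloc := locallyIntegrable_of_bounded hC hψ
  exact hnc (ae_const_of_mollify_const hloc fun w hw =>
    const_of_mollify_deriv_eq_zero hloc hw (mollify_deriv_eq_zero_of_iterate hC hψ k h w hw))

end Mollification

/-! ### Density of one-layer networks in `L²` of a finite measure -/

section Density

variable {u : ℝ} {ν : Measure (TimeInterval u)} [IsFiniteMeasure ν]

/-- By Fubini, a mollified neuron is an average of neurons with shifted bias `η - y`. -/
theorem integral_mul_mollify_eq_zero {ψ w : ℝ → ℝ} {C : ℝ} (hC : ∀ x, |ψ x| ≤ C)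
    (hψ : Measurable ψ) (hw : Integrable w) {f : TimeInterval u → ℝ} (hf : Integrable f ν)
    (h : ∀ a η : ℝ, ∫ t, f t * ψ (a * t + η) ∂ν = 0) (a η : ℝ) :
    ∫ t, f t * mollify ψ w (a * t + η) ∂ν = 0 := by
  have hint : Integrable (Function.uncurry fun (t : TimeInterval u) (y : ℝ) =>
      f t * (w y * ψ (a * t + η - y))) (ν.prod volume) := by
    have h1 := (hf.mul_prod hw).mul_bdd (c := C)
      (g := fun z : TimeInterval u × ℝ => ψ (a * z.1 + η - z.2))
      (hψ.comp (by fun_prop)).aestronglyMeasurable (ae_of_all _ fun z => hC _)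
    refine h1.congr (ae_of_all _ fun z => ?_)
    simp [Function.uncurry, mul_assoc]
  calc ∫ t, f t * mollify ψ w (a * t + η) ∂ν
      = ∫ t, (∫ y : ℝ, f t * (w y * ψ (a * t + η - y))) ∂ν := by
        simp only [mollify_apply, integral_const_mul]
    _ = ∫ y, ∫ t, f t * (w y * ψ (a * t + η - y)) ∂ν := integral_integral_swap hint
    _ = ∫ y, w y * ∫ t, f t * ψ (a * t + (η - y)) ∂ν := by
        congr 1 with y
        rw [← integral_const_mul]
        congr 1 with t
        rw [add_sub_assoc]
        ring
    _ = 0 := by simp [h]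

/-- Each derivative in the weight `a`, taken under the integral, brings down one factor `t` and puts
one more derivative on `w`. -/
theorem integral_mul_pow_mul_mollify_eq_zero {ψ w : ℝ → ℝ} {C : ℝ} (hC : ∀ x, |ψ x| ≤ C)
    (hψ : Measurable ψ) (hw : IsTestFunction w) {f : TimeInterval u → ℝ} (hf : Integrable f ν)
    (h : ∀ a η : ℝ, ∫ t, f t * ψ (a * t + η) ∂ν = 0) (k : ℕ) (a η : ℝ) :
    ∫ t, f t * (t : ℝ) ^ k * mollify ψ (deriv^[k] w) (a * t + η) ∂ν = 0 := by
  have hloc := locallyIntegrable_of_bounded hC hψ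
  induction k generalizing a η with
  | zero => simpa using integral_mul_mollify_eq_zero hC hψ hw.integrable hf h a η
  | succ k ih =>
    have hk := hw.iterate_deriv k
    have hpow : ∀ m : ℕ, Integrable (fun t : TimeInterval u => f t * (t : ℝ) ^ m) ν := fun m =>
      hf.mul_bdd (c := u ^ m) (by fun_prop) (ae_of_all _ fun t => by
        rw [Real.norm_eq_abs, abs_of_nonneg (pow_nonneg t.2.1 m)]
        exact pow_le_pow_left₀ t.2.1 t.2.2 m)
    set B := ∫ y, |deriv^[k + 1] w y| * C
    have hcont : ∀ m b, Continuous fun t : TimeInterval u =>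
        mollify ψ (deriv^[m] w) (b * t + η) := fun m b =>
      (continuous_mollify hloc (hw.iterate_deriv m)).comp (by fun_prop)
    have key := (hasDerivAt_integral_of_dominated_loc_of_deriv_le (μ := ν) (x₀ := a)
      (F := fun b (t : TimeInterval u) => f t * (t : ℝ) ^ k * mollify ψ (deriv^[k] w) (b * t + η))
      (F' := fun b (t : TimeInterval u) =>
        f t * (t : ℝ) ^ (k + 1) * mollify ψ (deriv^[k + 1] w) (b * t + η))
      (bound := fun t => |f t * (t : ℝ) ^ (k + 1)| * B) (s := Set.univ) Filter.univ_mem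
      (Filter.Eventually.of_forall fun b =>
        (hpow k).aestronglyMeasurable.mul (hcont k b).aestronglyMeasurable)
      ((hpow k).mul_bdd (hcont k a).aestronglyMeasurable
        (ae_of_all _ fun t => abs_mollify_le hC hk.integrable _))
      ((hpow (k + 1)).aestronglyMeasurable.mul (hcont (k + 1) a).aestronglyMeasurable)
      (ae_of_all _ fun t b _ => by
        rw [norm_mul, Real.norm_eq_abs, Real.norm_eq_abs]
        exact mul_le_mul_of_nonneg_left (abs_mollify_le hC (hw.iterate_deriv (k + 1)).integrable _)
          (abs_nonneg _))
      ((hpow (k + 1)).abs.mul_const B)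
      (ae_of_all _ fun t b _ => by
        have h1 : HasDerivAt (fun b : ℝ => b * (t : ℝ) + η) (t : ℝ) b := by
          simpa using ((hasDerivAt_id b).mul_const (t : ℝ)).add_const η
        have h2 := ((hasDerivAt_mollify hloc hk (b * t + η)).comp b h1).const_mul
          (f t * (t : ℝ) ^ k)
        refine h2.congr_deriv ?_
        rw [Function.iterate_succ_apply', pow_succ]
        ring)).2
    have hz : (fun b : ℝ => ∫ t, f t * (t : ℝ) ^ k * mollify ψ (deriv^[k] w) (b * t + η) ∂ν)
        = fun _ => (0 : ℝ) := funext fun b => ih b η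
    rw [hz] at key
    exact key.unique (hasDerivAt_const a 0)

theorem integral_mul_pow_eq_zero {ψ : ℝ → ℝ} {C : ℝ} (hC : ∀ x, |ψ x| ≤ C)
    (hψ : Measurable ψ) (hnc : ¬ ∃ c, ∀ᵐ x ∂(volume : Measure ℝ), ψ x = c)
    {f : TimeInterval u → ℝ} (hf : Integrable f ν)
    (h : ∀ a η : ℝ, ∫ t, f t * ψ (a * t + η) ∂ν = 0) (k : ℕ) :
    ∫ t, f t * (t : ℝ) ^ k ∂ν = 0 := by
  obtain ⟨w, hw, x, hx⟩ := exists_mollify_iterate_deriv_ne_zero hC hψ hnc k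
  -- At weight `0` the mollified neuron no longer depends on `t` and leaves the integral.
  have h0 := integral_mul_pow_mul_mollify_eq_zero hC hψ hw hf h k 0 x
  simp only [zero_mul, zero_add, integral_mul_const] at h0
  exact (mul_eq_zero.1 h0).resolve_right hx

/-- An element of `L²` orthogonal to all monomials vanishes. -/
theorem Lp_eq_zero_of_integral_mul_pow_eq_zero (f : Lp ℝ 2 ν)
    (h : ∀ k : ℕ, ∫ t, f t * (t : ℝ) ^ k ∂ν = 0) : f = 0 := by
  let T : C(TimeInterval u, ℝ) →L[ℝ] Lp ℝ 2 ν := ContinuousMap.toLp 2 ν ℝ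
  have hinner : ∀ g : C(TimeInterval u, ℝ), inner ℝ (T g) f = ∫ t, f t * g t ∂ν := by
    intro g
    rw [L2.inner_def]
    refine integral_congr_ae ?_
    filter_upwards [ContinuousMap.coeFn_toLp (p := 2) (𝕜 := ℝ) ν g] with t ht
    change inner ℝ (ContinuousMap.toLp 2 ν ℝ g t) (f t) = _
    rw [ht]
    rfl
  have hpoly : ∀ p : Polynomial ℝ, inner ℝ (T (p.toContinuousMapOn _)) f = 0 := by
    intro p
    induction p using Polynomial.induction_on' with
    | add p q hp hq =>
      have : (p + q).toContinuousMapOn (Set.Icc 0 u)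
          = p.toContinuousMapOn (Set.Icc 0 u) + q.toContinuousMapOn (Set.Icc 0 u) := by
        ext; simp
      rw [this, map_add, inner_add_left, hp, hq, add_zero]
    | monomial k a =>
      rw [hinner]
      have : ∀ t : TimeInterval u, f t * ((Polynomial.monomial k a).toContinuousMapOn _) t
          = a * (f t * (t : ℝ) ^ k) := fun t => by
        simp only [Polynomial.toContinuousMapOn_apply, Polynomial.toContinuousMap_apply,
          Polynomial.eval_monomial]
        ring
      simp only [this, integral_const_mul, h, mul_zero]
  have hcont : ∀ g : C(TimeInterval u, ℝ), inner ℝ (T g) f = 0 := by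
    have hcl : IsClosed {g : C(TimeInterval u, ℝ) | inner ℝ (T g) f = 0} :=
      isClosed_eq (by fun_prop) continuous_const
    intro g
    have hg : g ∈ (polynomialFunctions (Set.Icc 0 u)).topologicalClosure := by
      rw [polynomialFunctions_closure_eq_top]; trivial
    refine hcl.closure_subset_iff.2 ?_ hg
    intro q hq
    obtain ⟨p, rfl⟩ : q ∈ Set.range (Polynomial.toContinuousMapOnAlgHom (Set.Icc 0 u)) := by
      rw [← polynomialFunctions_coe]
      exact hq
    exact hpoly p
  have hdense : DenseRange T := ContinuousMap.toLp_denseRange ℝ ν ℝ (by norm_num)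
  have hall : ∀ g : Lp ℝ 2 ν, inner ℝ g f = 0 := fun g =>
    hdense.induction_on g (isClosed_eq (by fun_prop) continuous_const) hcont
  exact inner_self_eq_zero.1 (hall f)

/-- The scalar one-layer networks on `[0, u]` without output bias. -/
noncomputable def neuronSpan (u : ℝ) (ψ : ℝ → ℝ) : Submodule ℝ (TimeInterval u → ℝ) :=
  Submodule.span ℝ (Set.range fun (z : ℝ × ℝ) (t : TimeInterval u) => ψ (z.1 * t + z.2))

theorem memLp_neuron {ψ : ℝ → ℝ} {C : ℝ} (hC : ∀ x, |ψ x| ≤ C) (hψ : Measurable ψ) (a η : ℝ) :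
    MemLp (fun t : TimeInterval u => ψ (a * t + η)) 2 ν :=
  MemLp.of_bound (hψ.comp (by fun_prop)).aestronglyMeasurable C (ae_of_all _ fun _ => hC _)

/-- One-layer networks with a bounded, not almost everywhere constant activation function are dense
in `L²` of a finite measure on `[0, u]`. -/
theorem exists_neuronSpan_eLpNorm_sub_lt {ψ : ℝ → ℝ} {C : ℝ} (hC : ∀ x, |ψ x| ≤ C)
    (hψ : Measurable ψ) (hnc : ¬ ∃ c, ∀ᵐ x ∂(volume : Measure ℝ), ψ x = c)
    {f : TimeInterval u → ℝ} (hf : MemLp f 2 ν) {ε : ℝ} (hε : 0 < ε) :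
    ∃ g ∈ neuronSpan u ψ, eLpNorm (f - g) 2 ν < ENNReal.ofReal ε := by
  let K : Submodule ℝ (Lp ℝ 2 ν) :=
    { carrier := {F | ∃ g ∈ neuronSpan u ψ, F =ᵐ[ν] g}
      add_mem' := by
        rintro F G ⟨f, hf, hF⟩ ⟨g, hg, hG⟩
        exact ⟨f + g, add_mem hf hg, (Lp.coeFn_add F G).trans (hF.add hG)⟩
      zero_mem' := ⟨0, zero_mem _, Lp.coeFn_zero _ _ _⟩
      smul_mem' := by
        rintro c F ⟨f, hf, hF⟩
        exact ⟨c • f, Submodule.smul_mem _ c hf, (Lp.coeFn_smul c F).trans (hF.const_smul c)⟩ }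
  have hK : K.topologicalClosure = ⊤ := by
    -- Density is equivalent to a trivial orthogonal complement.
    rw [Submodule.topologicalClosure_eq_top_iff, Submodule.eq_bot_iff]
    intro F hF
    refine Lp_eq_zero_of_integral_mul_pow_eq_zero F
      (integral_mul_pow_eq_zero hC hψ hnc ((Lp.memLp F).integrable (by norm_num)) fun a η => ?_)
    have hmem := memLp_neuron (ν := ν) hC hψ a η
    have h0 := hF (hmem.toLp _) ⟨_, Submodule.subset_span ⟨(a, η), rfl⟩, hmem.coeFn_toLp⟩
    rw [L2.inner_def] at h0
    refine (integral_congr_ae ?_).trans h0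
    filter_upwards [hmem.coeFn_toLp] with t ht
    rw [ht]
    rfl
  have hmem : hf.toLp f ∈ closure (K : Set (Lp ℝ 2 ν)) := by
    rw [← Submodule.topologicalClosure_coe, hK]; trivial
  obtain ⟨G, ⟨g, hg, hGg⟩, hdist⟩ := EMetric.mem_closure_iff.1 hmem _ (ENNReal.ofReal_pos.2 hε)
  refine ⟨g, hg, ?_⟩
  rw [Lp.edist_def] at hdist
  rwa [eLpNorm_congr_ae (hf.coeFn_toLp.sub hGg)] at hdist

end Density

/-! ### Positive semidefiniteness of the density of a covariation process -/

section Positivity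

variable {u : ℝ}

/-- A density whose distribution function is nonnegative, monotone and continuous is
nonnegative almost everywhere. -/
theorem ae_nonneg_of_monotone_setIntegral_Iic {μ : Measure (TimeInterval u)}
    {h : TimeInterval u → ℝ} (hm : Measurable h) (hint : Integrable h μ)
    (hcont : Continuous fun t => ∫ s in Set.Iic t, h s ∂μ)
    (hmono : Monotone fun t => ∫ s in Set.Iic t, h s ∂μ)
    (hnonneg : ∀ t, 0 ≤ ∫ s in Set.Iic t, h s ∂μ) :
    ∀ᵐ s ∂μ, 0 ≤ h s := by
  set F : TimeInterval u → ℝ := fun t => ∫ s in Set.Iic t, h s ∂μ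
  rcases lt_or_ge u 0 with hu | hu
  · have : IsEmpty (TimeInterval u) := ⟨fun t => absurd (t.2.1.trans t.2.2) (not_le.2 hu)⟩
    exact ae_of_all _ fun s => isEmptyElim s
  let pos : Measure (TimeInterval u) := μ.withDensity fun s => ENNReal.ofReal (h s)
  let neg : Measure (TimeInterval u) := μ.withDensity fun s => ENNReal.ofReal (-h s)
  have hfin_pos : IsFiniteMeasure pos := isFiniteMeasure_withDensity_ofReal hint.2
  have hfin_neg : IsFiniteMeasure neg := isFiniteMeasure_withDensity_ofReal hint.neg.2
  -- Extension of `F` by zero to the left and by `F u` to the right. It may jump at `0`, where `F`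
  -- is only assumed nonnegative.
  let G : StieltjesFunction ℝ :=
    { toFun := fun x => if x < 0 then 0 else F (Set.projIcc 0 u hu x)
      mono' := by
        intro x y hxy
        dsimp only
        split_ifs with hx hy hy
        · exact le_rfl
        · exact hnonneg _
        · exact absurd (hxy.trans_lt hy) hx
        · exact hmono (Set.monotone_projIcc hu hxy)
      right_continuous' := by
        intro x
        rcases lt_or_ge x 0 with hx | hx
        · refine ContinuousAt.continuousWithinAt (continuousAt_const (y := (0 : ℝ)) |>.congr ?_)
          filter_upwards [Iio_mem_nhds hx] with y hy
          exact (if_pos hy).symm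
        · refine (hcont.comp (continuous_projIcc (h := hu))).continuousWithinAt.congr ?_ ?_
          · intro y hy
            exact if_neg (not_lt.2 (hx.trans hy))
          · exact if_neg (not_lt.2 hx) }
  have hGneg : ∀ x < 0, G x = 0 := fun x hx => if_pos hx
  have hGpos : ∀ x, 0 ≤ x → G x = F (Set.projIcc 0 u hu x) := fun x hx => if_neg (not_lt.2 hx)
  have hbot : Filter.Tendsto G Filter.atBot (nhds 0) := by
    refine tendsto_const_nhds.congr' ?_
    filter_upwards [Filter.Iio_mem_atBot (0 : ℝ)] with x hx
    exact (hGneg x hx).symm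
  have hval : Measurable (Subtype.val : TimeInterval u → ℝ) := measurable_subtype_coe
  have hmeas : ∀ t : TimeInterval u, pos (Set.Iic t) = neg (Set.Iic t) + ENNReal.ofReal (F t) := by
    intro t
    have e : F t = (pos (Set.Iic t)).toReal - (neg (Set.Iic t)).toReal := by
      rw [withDensity_apply _ measurableSet_Iic, withDensity_apply _ measurableSet_Iic]
      exact integral_eq_lintegral_pos_part_sub_lintegral_neg_part hint.integrableOn
    rw [← ENNReal.toReal_eq_toReal_iff' (measure_ne_top _ _)
      (ENNReal.add_ne_top.2 ⟨measure_ne_top _ _, ENNReal.ofReal_ne_top⟩),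
      ENNReal.toReal_add (measure_ne_top _ _) ENNReal.ofReal_ne_top,
      ENNReal.toReal_ofReal (hnonneg t)]
    linarith
  -- Both sides agree on half-lines. Hence `neg ≤ pos`, while `pos` vanishes on `{h < 0}`, so `neg`
  -- vanishes there too.
  have hsum : pos.map Subtype.val = neg.map Subtype.val + G.measure := by
    refine Measure.ext_of_Iic _ _ fun x => ?_
    rw [Measure.add_apply, Measure.map_apply hval measurableSet_Iic,
      Measure.map_apply hval measurableSet_Iic, G.measure_Iic hbot, sub_zero]
    rcases lt_or_ge x 0 with hx | hx
    · have : (Subtype.val : TimeInterval u → ℝ) ⁻¹' Set.Iic x = ∅ :=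
        Set.eq_empty_of_forall_notMem fun t ht => absurd (t.2.1.trans ht) (not_le.2 hx)
      simp [this, hGneg x hx]
    · have : (Subtype.val : TimeInterval u → ℝ) ⁻¹' Set.Iic x
          = Set.Iic (Set.projIcc 0 u hu x) := by
        ext t
        have h1 := t.2.1
        have h2 := t.2.2
        simp only [Set.mem_preimage, Set.mem_Iic, ← Subtype.coe_le_coe, Set.coe_projIcc, le_max_iff,
          le_min_iff]
        constructor
        · exact fun h => Or.inr ⟨h2, h⟩
        · rintro (h | h)
          · exact h.trans hx
          · exact h.2
      rw [this, hGpos x hx, hmeas]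
  have hle : ∀ s : Set (TimeInterval u), MeasurableSet s → neg s ≤ pos s := by
    intro s hs
    have hemb : MeasurableEmbedding (Subtype.val : TimeInterval u → ℝ) :=
      MeasurableEmbedding.subtype_coe measurableSet_Icc
    have h1 := congrArg (fun m => m (Subtype.val '' s)) hsum
    simp only [Measure.add_apply, hemb.map_apply, Set.preimage_image_eq s
      Subtype.val_injective] at h1
    rw [h1]
    exact le_self_add
  let N : Set (TimeInterval u) := {s | h s < 0}
  have hN : MeasurableSet N := measurableSet_lt hm measurable_const
  have h1 : neg N ≤ 0 := by
    refine (hle N hN).trans_eq ?_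
    rw [withDensity_apply _ hN, setLIntegral_congr_fun hN (g := fun _ => 0)
      (fun s hs => ENNReal.ofReal_of_nonpos (le_of_lt hs))]
    simp
  have h2 : ∫⁻ s in N, ENNReal.ofReal (-h s) ∂μ = 0 := by
    rw [← withDensity_apply _ hN]
    exact le_antisymm h1 zero_le
  rw [lintegral_eq_zero_iff (by fun_prop)] at h2
  have h3 := (ae_restrict_iff' hN).1 h2
  filter_upwards [h3] with s hs
  by_contra hneg
  have h4 := ENNReal.ofReal_eq_zero.1 (hs (not_le.1 hneg))
  linarith [not_le.1 hneg]

/-- The uniform subdivision of `[0, s]` into `n + 1` steps, followed by that of `[s, t]`. -/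
noncomputable def twoPieceSubdivision (s t : TimeInterval u) (hst : s ≤ t) (n k : ℕ) :
    TimeInterval u :=
  ⟨(s : ℝ) * min 1 ((k : ℝ) / (n + 1)) + ((t : ℝ) - s) * min 1 (max 0 ((k : ℝ) / (n + 1) - 1)), by
    have h1 : (0 : ℝ) ≤ min 1 ((k : ℝ) / (n + 1)) := le_min zero_le_one (by positivity)
    have h2 : (0 : ℝ) ≤ min 1 (max 0 ((k : ℝ) / (n + 1) - 1)) :=
      le_min zero_le_one (le_max_left _ _)
    have h3 : (0 : ℝ) ≤ t - s := sub_nonneg.2 hst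
    constructor
    · have := mul_nonneg s.2.1 h1
      have := mul_nonneg h3 h2
      linarith
    · have := mul_le_mul_of_nonneg_left (min_le_left (1 : ℝ) ((k : ℝ) / (n + 1))) s.2.1
      have := mul_le_mul_of_nonneg_left
        (min_le_left (1 : ℝ) (max 0 ((k : ℝ) / (n + 1) - 1))) h3
      linarith [t.2.2]⟩

variable (s t : TimeInterval u) (hst : s ≤ t)

theorem coe_twoPieceSubdivision (n k : ℕ) : (twoPieceSubdivision s t hst n k : ℝ) =
    (s : ℝ) * min 1 ((k : ℝ) / (n + 1)) + ((t : ℝ) - s) * min 1 (max 0 ((k : ℝ) / (n + 1) - 1)) := rfl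

theorem monotone_twoPieceSubdivision (n : ℕ) : Monotone (twoPieceSubdivision s t hst n) := by
  intro k l hkl
  have h3 : (0 : ℝ) ≤ t - s := sub_nonneg.2 hst
  have h0 : (0 : ℝ) ≤ s := s.2.1
  rw [← Subtype.coe_le_coe, coe_twoPieceSubdivision, coe_twoPieceSubdivision]
  gcongr

theorem twoPieceSubdivision_zero (n : ℕ) : (twoPieceSubdivision s t hst n 0 : ℝ) = 0 := by
  simp [coe_twoPieceSubdivision]

theorem twoPieceSubdivision_mid (n : ℕ) : twoPieceSubdivision s t hst n (n + 1) = s := by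
  have h : ((n : ℝ) + 1) / (n + 1) = 1 := div_self (by positivity)
  ext
  simp [coe_twoPieceSubdivision, h]

theorem twoPieceSubdivision_last (n : ℕ) :
    twoPieceSubdivision s t hst n (2 * (n + 1)) = t := by
  have h : (2 * ((n : ℝ) + 1)) / (n + 1) = 2 := mul_div_cancel_right₀ _ (by positivity)
  ext
  simp only [coe_twoPieceSubdivision, Nat.cast_mul, Nat.cast_ofNat, Nat.cast_add, Nat.cast_one, h]
  norm_num

/-- Truncation is 1-Lipschitz, so with `δ = 1 / (n + 1)` a step is at most `s δ + (t - s) δ`. -/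
theorem twoPieceSubdivision_step_le (n k : ℕ) :
    (twoPieceSubdivision s t hst n (k + 1) : ℝ) - twoPieceSubdivision s t hst n k
      ≤ t * (1 / (n + 1)) := by
  have h3 : (0 : ℝ) ≤ t - s := sub_nonneg.2 hst
  have hδ : (0 : ℝ) ≤ 1 / (n + 1) := by positivity
  have hk : ((k + 1 : ℕ) : ℝ) / (n + 1) = k / (n + 1) + 1 / (n + 1) := by
    push_cast
    ring
  rw [coe_twoPieceSubdivision, coe_twoPieceSubdivision, hk]
  generalize (1 : ℝ) / (n + 1) = δ at *
  generalize (k : ℝ) / (n + 1) = r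
  have e1 : min 1 (r + δ) ≤ min 1 r + δ := by
    rw [← min_add_add_right]
    exact min_le_min (by linarith) le_rfl
  have e2 : min 1 (max 0 (r + δ - 1)) ≤ min 1 (max 0 (r - 1)) + δ := by
    rw [← min_add_add_right, ← max_add_add_right]
    exact min_le_min (by linarith) (max_le_max (by linarith) (by linarith))
  have f1 := mul_le_mul_of_nonneg_left e1 s.2.1
  have f2 := mul_le_mul_of_nonneg_left e2 h3
  linarith

theorem twoPieceSubdivision_mesh {ε : ℝ} (hε : 0 < ε) : ∀ᶠ n in Filter.atTop, ∀ k : ℕ,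
    (twoPieceSubdivision s t hst n (k + 1) : ℝ) - twoPieceSubdivision s t hst n k < ε := by
  have h := (tendsto_one_div_add_atTop_nhds_zero_nat (𝕜 := ℝ)).const_mul (t : ℝ)
  rw [mul_zero] at h
  filter_upwards [h.eventually_lt_const hε] with n hn k
  exact (twoPieceSubdivision_step_le s t hst n k).trans_lt hn

end Positivity

/-! ### Monotonicity of a deterministic covariation matrix -/

section Covariation

variable {Ω : Type*} [mΩ : MeasurableSpace Ω] {P : Measure Ω}

/-- Finitely many sequences converging in probability are simultaneously close to their limits at
some sample point. -/
theorem exists_forall_dist_lt_of_tendstoInMeasure [IsProbabilityMeasure P] {ι : Type*} [Fintype ι]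
    {S : ι → ℕ → Ω → ℝ} {c : ι → Ω → ℝ}
    (h : ∀ i, TendstoInMeasure P (S i) Filter.atTop (c i)) {ε : ℝ} (hε : 0 < ε) :
    ∃ n ω, ∀ i, dist (S i n ω) (c i ω) < ε := by
  have hsum : Filter.Tendsto (fun n => ∑ i, P {ω | ε ≤ dist (S i n ω) (c i ω)})
      Filter.atTop (nhds 0) := by
    simpa using tendsto_finsetSum Finset.univ fun i _ => tendstoInMeasure_iff_dist.1 (h i) ε hε
  obtain ⟨n, hn⟩ := (hsum.eventually_lt_const zero_lt_one).exists
  refine ⟨n, ?_⟩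
  by_contra! hcon
  have huniv : (Set.univ : Set Ω) ⊆ ⋃ i, {ω | ε ≤ dist (S i n ω) (c i ω)} := fun ω _ =>
    Set.mem_iUnion.2 (hcon ω)
  have := (measure_mono huniv).trans (measure_iUnion_fintype_le P _)
  rw [measure_univ] at this
  exact absurd (this.trans_lt hn) (lt_irrefl _)

variable {u : ℝ} {d : ℕ} [IsProbabilityMeasure P] {M : TimeInterval u → Ω → Fin d → ℝ}
  {A : TimeInterval u → Matrix (Fin d) (Fin d) ℝ}

/-- Partitions with no steps are admissible at time `0`, and their sums are empty. -/
theorem IsCovariation.eq_zero_at_zero {X Y : TimeInterval u → Ω → ℝ} {V : TimeInterval u → ℝ}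
    (h : IsCovariation P X Y fun t _ => V t) {t : TimeInterval u} (ht : (t : ℝ) = 0) : V t = 0 := by
  have h1 := h.tendsto_sums t (fun _ => 0) (fun _ _ => t) (fun _ => monotone_const) (fun _ => ht)
    (fun _ => rfl) (fun ε hε => Filter.Eventually.of_forall fun n k hk => by simp at hk)
  by_contra hV
  obtain ⟨n, ω, hω⟩ := exists_forall_dist_lt_of_tendstoInMeasure (ι := Unit) (fun _ => h1)
    (abs_pos.2 hV)
  simpa using hω ()

theorem IsCovariation.continuous {X Y : TimeInterval u → Ω → ℝ} {V : TimeInterval u → ℝ}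
    (h : IsCovariation P X Y fun t _ => V t) : Continuous V :=
  h.continuous_paths.exists.choose_spec

/-- The quadratic forms of a deterministic covariation matrix are nondecreasing in time. -/
theorem quadraticForm_covariation_mono
    (hA : ∀ i j, IsCovariation P (fun t ω => M t ω i) (fun t ω => M t ω j) fun t _ => A t i j)
    (x : Fin d → ℝ) : Monotone fun t => x ⬝ᵥ (A t).mulVec x := by
  intro s t hst
  have hexp : ∀ B : Matrix (Fin d) (Fin d) ℝ,
      x ⬝ᵥ B.mulVec x = ∑ z : Fin d × Fin d, x z.1 * x z.2 * B z.1 z.2 := by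
    intro B
    simp only [dotProduct, Matrix.mulVec, Finset.mul_sum, Fintype.sum_prod_type]
    exact Finset.sum_congr rfl fun i _ => Finset.sum_congr rfl fun j _ => by ring
  set p := twoPieceSubdivision s t hst
  let D : ℕ → ℕ → Ω → Fin d → ℝ := fun n k ω i => M (p n (k + 1)) ω i - M (p n k) ω i
  -- One partition serves both times: the sum for `s` (`true`) is the initial segment, up to index
  -- `n + 1`, of the sum for `t` (`false`).
  let S : Bool × (Fin d × Fin d) → ℕ → Ω → ℝ := fun z n ω =>
    ∑ k ∈ Finset.range (if z.1 then n + 1 else 2 * (n + 1)), D n k ω z.2.1 * D n k ω z.2.2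
  let c : Bool × (Fin d × Fin d) → Ω → ℝ := fun z _ => A (if z.1 then s else t) z.2.1 z.2.2
  have hS : ∀ z, TendstoInMeasure P (S z) Filter.atTop (c z) := by
    rintro ⟨b, i, j⟩
    refine (hA i j).tendsto_sums (if b then s else t)
      (fun n => if b then n + 1 else 2 * (n + 1)) p
      (monotone_twoPieceSubdivision s t hst) (twoPieceSubdivision_zero s t hst) (fun n => ?_)
      (fun ε hε => ?_)
    · cases b
      · exact twoPieceSubdivision_last s t hst n
      · exact twoPieceSubdivision_mid s t hst n
    · filter_upwards [twoPieceSubdivision_mesh s t hst hε] with n hn k _ using hn k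
  refine le_of_forall_pos_le_add fun ε hε => ?_
  set R := ∑ z : Fin d × Fin d, |x z.1 * x z.2| with hR
  have hR0 : 0 ≤ R := Finset.sum_nonneg fun _ _ => abs_nonneg _
  -- Since the limits are deterministic, one sample point suffices. The tolerance makes the errors
  -- at `s` and `t`, each at most `R δ`, add up to at most `ε`; `R + 1` covers `R = 0`.
  obtain ⟨n, ω, hω⟩ := exists_forall_dist_lt_of_tendstoInMeasure hS
    (show 0 < ε / (2 * (R + 1)) by positivity)
  set δ := ε / (2 * (R + 1)) with hδ
  have hsq : ∀ m, ∑ z : Fin d × Fin d, x z.1 * x z.2 * ∑ k ∈ Finset.range m,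
      D n k ω z.1 * D n k ω z.2 = ∑ k ∈ Finset.range m, (∑ i, x i * D n k ω i) ^ 2 := by
    intro m
    simp only [Finset.mul_sum]
    rw [Finset.sum_comm]
    refine Finset.sum_congr rfl fun k _ => ?_
    rw [sq, Finset.sum_mul_sum, Fintype.sum_prod_type]
    exact Finset.sum_congr rfl fun i _ => Finset.sum_congr rfl fun j _ => by ring
  have hcmp : ∑ z : Fin d × Fin d, x z.1 * x z.2 * S (true, z) n ω
      ≤ ∑ z : Fin d × Fin d, x z.1 * x z.2 * S (false, z) n ω := by
    simp only [S, if_true, Bool.false_eq_true, if_false]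
    rw [hsq, hsq]
    exact Finset.sum_le_sum_of_subset_of_nonneg
      (Finset.range_subset_range.2 (by omega)) fun _ _ _ => sq_nonneg _
  have hclose : ∀ b, |∑ z : Fin d × Fin d, x z.1 * x z.2 * S (b, z) n ω
      - ∑ z : Fin d × Fin d, x z.1 * x z.2 * c (b, z) ω| ≤ R * δ := by
    intro b
    rw [← Finset.sum_sub_distrib, hR, Finset.sum_mul]
    refine (Finset.abs_sum_le_sum_abs _ _).trans (Finset.sum_le_sum fun z _ => ?_)
    rw [← mul_sub, abs_mul]
    exact mul_le_mul_of_nonneg_left (hω (b, z)).le (abs_nonneg _)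
  have hfin : 2 * (R * δ) ≤ ε := by
    rw [hδ]
    have : 2 * (R * (ε / (2 * (R + 1)))) = ε * (R / (R + 1)) := by
      field_simp
    rw [this]
    exact mul_le_of_le_one_right hε.le ((div_le_one (by linarith)).2 (by linarith))
  have ht := abs_le.1 (hclose false)
  have hs := abs_le.1 (hclose true)
  simp only [c, if_true, Bool.false_eq_true, if_false] at ht hs
  simp only [hexp]
  linarith [ht.1, ht.2, hs.1, hs.2]

end Covariation

/-! ### Positive semidefiniteness of `π` and the diagonal bound -/

section PosSemidef

variable {Ω : Type*} [mΩ : MeasurableSpace Ω] {P : Measure Ω} [IsProbabilityMeasure P]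
  {u : ℝ} {d : ℕ} {M : TimeInterval u → Ω → Fin d → ℝ}
  {A π : TimeInterval u → Matrix (Fin d) (Fin d) ℝ} {μ : Measure (TimeInterval u)}

theorem dotProduct_mulVec_eq_sum (B : Matrix (Fin d) (Fin d) ℝ) (x : Fin d → ℝ) :
    x ⬝ᵥ B.mulVec x = ∑ i, ∑ j, x i * x j * B i j := by
  simp only [dotProduct, Matrix.mulVec, Finset.mul_sum]
  exact Finset.sum_congr rfl fun i _ => Finset.sum_congr rfl fun j _ => by ring

theorem IsRepresentation.integrable_quadraticForm (hπ : IsRepresentation A π μ) (x : Fin d → ℝ) :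
    Integrable (fun s => x ⬝ᵥ (π s).mulVec x) μ := by
  simp only [dotProduct_mulVec_eq_sum]
  exact integrable_finsetSum _ fun i _ => integrable_finsetSum _ fun j _ =>
    (hπ.integrable i j).const_mul _

theorem IsRepresentation.quadraticForm_eq_setIntegral (hπ : IsRepresentation A π μ)
    (x : Fin d → ℝ) (t : TimeInterval u) :
    x ⬝ᵥ (A t).mulVec x = ∫ s in Set.Iic t, x ⬝ᵥ (π s).mulVec x ∂μ := by
  have hint : ∀ i j, Integrable (fun s => x i * x j * π s i j) (μ.restrict (Set.Iic t)) :=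
    fun i j => (hπ.integrable i j).integrableOn.const_mul _
  simp only [dotProduct_mulVec_eq_sum]
  rw [integral_finsetSum _ fun i _ => integrable_finsetSum _ fun j _ => hint i j]
  refine Finset.sum_congr rfl fun i _ => ?_
  rw [integral_finsetSum _ fun j _ => hint i j]
  exact Finset.sum_congr rfl fun j _ => by rw [hπ.eq_integral, integral_const_mul]

/-- The density of a deterministic covariation matrix is almost everywhere positive semidefinite. -/
theorem ae_quadraticForm_nonneg
    (hA : ∀ i j, IsCovariation P (fun t ω => M t ω i) (fun t ω => M t ω j) fun t _ => A t i j)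
    (hπ : IsRepresentation A π μ) :
    ∀ᵐ s ∂μ, ∀ x : Fin d → ℝ, 0 ≤ x ⬝ᵥ (π s).mulVec x := by
  have hfix : ∀ x : Fin d → ℝ, ∀ᵐ s ∂μ, 0 ≤ x ⬝ᵥ (π s).mulVec x := by
    intro x
    have hmono := quadraticForm_covariation_mono hA x
    have hcont : Continuous fun t => x ⬝ᵥ (A t).mulVec x := by
      simp only [dotProduct_mulVec_eq_sum]
      exact continuous_finsetSum _ fun i _ => continuous_finsetSum _ fun j _ =>
        continuous_const.mul (hA i j).continuous
    have hnonneg : ∀ t, 0 ≤ x ⬝ᵥ (A t).mulVec x := by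
      intro t
      let o : TimeInterval u := ⟨0, le_rfl, t.2.1.trans t.2.2⟩
      have ho : A o = 0 := Matrix.ext fun i j => (hA i j).eq_zero_at_zero (t := o) rfl
      have := hmono (show o ≤ t from t.2.1)
      simpa [ho] using this
    simp only [hπ.quadraticForm_eq_setIntegral] at hmono hcont hnonneg
    refine ae_nonneg_of_monotone_setIntegral_Iic ?_ (hπ.integrable_quadraticForm x) hcont hmono
      hnonneg
    simp only [dotProduct_mulVec_eq_sum]
    exact Finset.measurable_sum _ fun i _ => Finset.measurable_sum _ fun j _ =>
      (hπ.measurable i j).const_mul _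
  -- The null set depends on `x`; a countable dense set and continuity in `x` yield a common one.
  filter_upwards [ae_all_iff.2 fun n => hfix (TopologicalSpace.denseSeq (Fin d → ℝ) n)] with s hs x
  refine (TopologicalSpace.denseRange_denseSeq (Fin d → ℝ)).induction_on x
    (isClosed_le continuous_const ?_) hs
  simp only [dotProduct_mulVec_eq_sum]
  fun_prop

/-- A positive semidefinite quadratic form in dimension `d` is at most `d` times its diagonal. -/
theorem dotProduct_mulVec_le_diagonal {B : Matrix (Fin d) (Fin d) ℝ} (hB : B.IsSymm)
    (hpos : ∀ x : Fin d → ℝ, 0 ≤ x ⬝ᵥ B.mulVec x) (x : Fin d → ℝ) :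
    x ⬝ᵥ B.mulVec x ≤ d * ∑ i, B i i * x i ^ 2 := by
  have hij : ∀ i j, x i * x j * B i j ≤ (B i i * x i ^ 2 + B j j * x j ^ 2) / 2 := by
    intro i j
    -- Testing on `x_i e_i - x_j e_j` bounds the cross term by the two diagonal ones.
    have h := hpos (Pi.single i (x i) - Pi.single j (x j))
    have hs : B j i = B i j := hB.apply i j
    simp only [Matrix.mulVec_sub, sub_dotProduct, dotProduct_sub, single_dotProduct,
      Matrix.mulVec_single, Pi.smul_apply, MulOpposite.smul_eq_mul_unop, MulOpposite.unop_op,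
      Matrix.col_apply, hs] at h
    nlinarith [h]
  rw [dotProduct_mulVec_eq_sum]
  refine (Finset.sum_le_sum fun i _ => Finset.sum_le_sum fun j _ => hij i j).trans_eq ?_
  simp only [← Finset.sum_div, Finset.sum_add_distrib, Finset.sum_const, Finset.card_univ,
    Fintype.card_fin, nsmul_eq_mul, ← Finset.mul_sum]
  ring

end PosSemidef

/-! ### Comparison of `Λ^{2,0}` with `Λ²` -/

section WeightedSpace

variable {u : ℝ} {d : ℕ} {A π : TimeInterval u → Matrix (Fin d) (Fin d) ℝ}
  {μ : Measure (TimeInterval u)}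

theorem IsRepresentation.isFiniteMeasure_diagMeasure (hπ : IsRepresentation A π μ) (i : Fin d) :
    IsFiniteMeasure (diagMeasure π μ i) :=
  isFiniteMeasure_withDensity_ofReal (hπ.integrable i i).2

theorem integral_sq_lt_of_eLpNorm_lt {α : Type*} [MeasurableSpace α] {ν : Measure α} {h : α → ℝ}
    (hh : MemLp h 2 ν) {δ : ℝ} (hδ : 0 < δ) (hlt : eLpNorm h 2 ν < ENNReal.ofReal δ) :
    ∫ s, h s ^ 2 ∂ν < δ ^ 2 := by
  rw [hh.eLpNorm_eq_integral_rpow_norm (by norm_num) (by norm_num),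
    ENNReal.ofReal_lt_ofReal_iff hδ] at hlt
  simp only [ENNReal.toReal_ofNat, Real.rpow_two, Real.norm_eq_abs, sq_abs] at hlt
  rw [← Real.sqrt_lt' hδ, Real.sqrt_eq_rpow, one_div]
  exact hlt

/-- `diagMeasure` truncates its density at zero; positivity on the unit vectors makes the truncation
harmless almost everywhere. -/
theorem integral_diag_mul_sq (hπ : IsRepresentation A π μ)
    (hpos : ∀ᵐ s ∂μ, ∀ x : Fin d → ℝ, 0 ≤ x ⬝ᵥ (π s).mulVec x)
    (i : Fin d) {h : TimeInterval u → ℝ}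
    (hh : MemLp h 2 (diagMeasure π μ i)) :
    Integrable (fun s => π s i i * h s ^ 2) μ ∧
      ∫ s, π s i i * h s ^ 2 ∂μ = ∫ s, h s ^ 2 ∂(diagMeasure π μ i) := by
  have hm : Measurable fun s => ENNReal.ofReal (π s i i) := (hπ.measurable i i).ennreal_ofReal
  have hfin : ∀ᵐ s ∂μ, ENNReal.ofReal (π s i i) < ⊤ := ae_of_all _ fun s => ENNReal.ofReal_lt_top
  have heq : (fun s => (ENNReal.ofReal (π s i i)).toReal • h s ^ 2)
      =ᵐ[μ] fun s => π s i i * h s ^ 2 := by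
    filter_upwards [hpos] with s hs
    have := hs (Pi.single i 1)
    simp at this
    rw [ENNReal.toReal_ofReal this, smul_eq_mul]
  constructor
  · exact ((integrable_withDensity_iff_integrable_smul' hm hfin).1 hh.integrable_sq).congr heq
  · rw [diagMeasure, integral_withDensity_eq_integral_toReal_smul hm hfin]
    exact (integral_congr_ae heq).symm

/-- `Λ^{2,0}` embeds continuously into `Λ²`. -/
theorem mem_Lambda2_and_integral_quadForm_le (hπ : IsRepresentation A π μ)
    (hpos : ∀ᵐ s ∂μ, ∀ x : Fin d → ℝ, 0 ≤ x ⬝ᵥ (π s).mulVec x)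
    {h : TimeInterval u → Fin d → ℝ}
    (hh : h ∈ Lambda20 π μ) :
    h ∈ Lambda2 π μ ∧
      ∫ s, quadForm π h s ∂μ ≤ d * ∑ i, ∫ s, h s i ^ 2 ∂(diagMeasure π μ i) := by
  have hdiag := fun i => integral_diag_mul_sq hπ hpos i (hh.2 i)
  have hbound : Integrable (fun s => (d : ℝ) * ∑ i, π s i i * h s i ^ 2) μ :=
    (integrable_finsetSum _ fun i _ => (hdiag i).1).const_mul _
  have hle : ∀ᵐ s ∂μ, quadForm π h s ≤ d * ∑ i, π s i i * h s i ^ 2 := by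
    filter_upwards [hpos] with s hs
    exact dotProduct_mulVec_le_diagonal (hπ.symm s) hs (h s)
  have hmeas : Measurable (quadForm π h) := by
    unfold quadForm
    simp only [dotProduct_mulVec_eq_sum]
    exact Finset.measurable_sum _ fun i _ => Finset.measurable_sum _ fun j _ =>
      (((measurable_pi_apply i).comp hh.1).mul ((measurable_pi_apply j).comp hh.1)).mul
        (hπ.measurable i j)
  have hint : Integrable (quadForm π h) μ := by
    refine hbound.mono' hmeas.aestronglyMeasurable ?_
    filter_upwards [hpos, hle] with s hs hs'
    rw [Real.norm_eq_abs, abs_of_nonneg (show 0 ≤ quadForm π h s from hs (h s))]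
    exact hs'
  refine ⟨⟨hh.1, hint⟩, (integral_mono_ae hint hbound hle).trans_eq ?_⟩
  rw [integral_const_mul, integral_finsetSum _ fun i _ => (hdiag i).1]
  simp only [(hdiag _).2]

end WeightedSpace

/-! ### The space of one-layer networks -/

section Networks

variable {u : ℝ} {d : ℕ} {ψ : ℝ → ℝ}

theorem mem_NNOn_one_top_iff {g : TimeInterval u → Fin d → ℝ} :
    g ∈ NNOn u ψ 1 ⊤ d ↔ ∃ (n : ℕ) (α η : Fin n → ℝ) (W : Fin d → Fin n → ℝ) (b : Fin d → ℝ),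
      ∀ t i, g t i = ∑ j, W i j * ψ (α j * t + η j) + b i := by
  constructor
  · rintro ⟨f, ⟨n, h, hh, W, b, rfl⟩, hg⟩
    cases hh with
    | step hh _ _ V c =>
      cases hh with
      | input =>
        refine ⟨n, fun j => V j 0, c, W, b, fun t i => ?_⟩
        rw [hg t]
        simp [Matrix.mulVec, dotProduct]
  · rintro ⟨n, α, η, W, b, hg⟩
    refine ⟨_, ⟨n, _, IsHiddenLayer.step IsHiddenLayer.input n le_top (Matrix.of fun j _ => α j) η,
      Matrix.of W, b, rfl⟩, fun t => funext fun i => ?_⟩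
    rw [hg t i]
    simp [Matrix.mulVec, dotProduct]

/-- `NN_{1,∞}^d(ψ)`, as a linear subspace of the functions on `[0, u]`. -/
def networkSubmodule (u : ℝ) (ψ : ℝ → ℝ) (d : ℕ) : Submodule ℝ (TimeInterval u → Fin d → ℝ) where
  carrier := NNOn u ψ 1 ⊤ d
  add_mem' := by
    intro f g hf hg
    rw [mem_NNOn_one_top_iff] at hf hg ⊢
    obtain ⟨n, α, η, W, b, hf⟩ := hf
    obtain ⟨m, β, θ, V, c, hg⟩ := hg
    -- The two hidden layers side by side.
    refine ⟨n + m, Fin.append α β, Fin.append η θ, fun i => Fin.append (W i) (V i), b + c,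
      fun t i => ?_⟩
    simp only [Pi.add_apply, hf, hg, Fin.sum_univ_add, Fin.append_left, Fin.append_right]
    ring
  zero_mem' := mem_NNOn_one_top_iff.2 ⟨0, 0, 0, 0, 0, fun t i => by simp⟩
  smul_mem' := by
    intro r f hf
    rw [mem_NNOn_one_top_iff] at hf ⊢
    obtain ⟨n, α, η, W, b, hf⟩ := hf
    refine ⟨n, α, η, fun i j => r * W i j, r • b, fun t i => ?_⟩
    simp only [Pi.smul_apply, smul_eq_mul, hf, mul_add, Finset.mul_sum, mul_assoc]

theorem single_mem_networkSubmodule (i : Fin d) {g : TimeInterval u → ℝ}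
    (hg : g ∈ neuronSpan u ψ) :
    (fun t => Pi.single i (g t)) ∈ networkSubmodule u ψ d := by
  induction hg using Submodule.span_induction with
  | mem g hg =>
    obtain ⟨z, rfl⟩ := hg
    refine mem_NNOn_one_top_iff.2 ⟨1, fun _ => z.1, fun _ => z.2,
      fun k _ => (Pi.single i 1 : Fin d → ℝ) k, 0, fun t k => ?_⟩
    by_cases hk : k = i
    · subst hk; simp
    · simp [hk]
  | zero =>
    convert zero_mem (networkSubmodule u ψ d) using 1
    ext t k
    simp
  | add g₁ g₂ _ _ h₁ h₂ =>
    convert add_mem h₁ h₂ using 1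
    ext t k
    simp [Pi.single_add]
  | smul c g _ h =>
    convert Submodule.smul_mem _ c h using 1
    ext t k
    simp [Pi.single_apply]

theorem mem_networkSubmodule_of_forall {g : TimeInterval u → Fin d → ℝ}
    (hg : ∀ i, (fun t => g t i) ∈ neuronSpan u ψ) : g ∈ networkSubmodule u ψ d := by
  have h : g = ∑ i, fun t => Pi.single i (g t i) := by
    ext t k
    simp [Finset.sum_apply, Pi.single_apply]
  rw [h]
  exact sum_mem fun i _ => single_mem_networkSubmodule i (hg i)

theorem networkSubmodule_le_Lambda20 {A π : TimeInterval u → Matrix (Fin d) (Fin d) ℝ}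
    {μ : Measure (TimeInterval u)} (hπ : IsRepresentation A π μ) {C : ℝ} (hC : ∀ x, |ψ x| ≤ C)
    (hψ : Measurable ψ) : networkSubmodule u ψ d ≤ Lambda20 π μ := by
  intro g hg
  obtain ⟨n, α, η, W, b, hg⟩ := mem_NNOn_one_top_iff.1 hg
  refine ⟨measurable_pi_iff.2 fun i => ?_, fun i => ?_⟩
  · simp only [hg]
    exact (Finset.measurable_sum _ fun j _ =>
      (hψ.comp (by fun_prop)).const_mul (W i j)).add_const _
  · have := hπ.isFiniteMeasure_diagMeasure i
    simp only [hg]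
    exact (memLp_finsetSum _ fun j _ =>
      (memLp_neuron hC hψ (α j) (η j)).const_mul (W i j)).add (memLp_const _)

end Networks

/-- The clause `f - g ∈ Lambda2 π μ` gives the norm bound its content, since the integral of a
nonintegrable function is `0` by convention. -/
theorem mainTheorem6 {Ω : Type*} [mΩ : MeasurableSpace Ω] (P : Measure Ω) [IsProbabilityMeasure P]
    (u : ℝ) [Fact (0 < u)] (d : ℕ)
    (ℱ : Filtration (TimeInterval u) mΩ)
    (hℱ : ∀ t s, MeasurableSet s → P s = 0 → MeasurableSet[ℱ t] s)
    (M : TimeInterval u → Ω → Fin d → ℝ)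
    (hM : ∀ i, IsContinuousLocalMartingale ℱ P fun t ω => M t ω i)
    (A : TimeInterval u → Matrix (Fin d) (Fin d) ℝ)
    (hA : ∀ i j, IsCovariation P (fun t ω => M t ω i) (fun t ω => M t ω j) fun t _ => A t i j)
    (hA_pos : ∀ t : TimeInterval u, (t : ℝ) = u → 0 < (A t).trace)
    (μ : Measure (TimeInterval u)) [IsFiniteMeasure μ]
    (π : TimeInterval u → Matrix (Fin d) (Fin d) ℝ)
    (hπ : IsRepresentation A π μ)
    (ψ : ℝ → ℝ) (hψ_bdd : ∃ C, ∀ x, |ψ x| ≤ C) (hψ_meas : Measurable ψ)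
    (hψ_nonconst : ¬ ∃ c, ∀ᵐ x ∂(volume : Measure ℝ), ψ x = c) :
    ∃ D : Submodule ℝ (TimeInterval u → Fin d → ℝ),
      (D : Set (TimeInterval u → Fin d → ℝ)) = NNOn u ψ 1 ⊤ d ∧
      D ≤ Lambda20 π μ ∧
      ∀ f ∈ Lambda20 π μ, ∀ ε > 0, ∃ g ∈ D, f - g ∈ Lambda2 π μ ∧ lambdaNorm π μ (f - g) < ε := by
  obtain ⟨C, hC⟩ := hψ_bdd
  have hpos := ae_quadraticForm_nonneg hA hπ
  have hsub := networkSubmodule_le_Lambda20 (d := d) hπ hC hψ_meas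
  refine ⟨networkSubmodule u ψ d, rfl, hsub, fun f hf ε hε => ?_⟩
  -- One factor `d` comes from the diagonal bound and one from summing over coordinates; `d + 1`
  -- gives strict inequality and covers `d = 0`.
  have hδ : 0 < ε / (d + 1) := by positivity
  have happrox : ∀ i, ∃ g ∈ neuronSpan u ψ,
      eLpNorm ((fun s => f s i) - g) 2 (diagMeasure π μ i) < ENNReal.ofReal (ε / (d + 1)) := by
    intro i
    have := hπ.isFiniteMeasure_diagMeasure i
    exact exists_neuronSpan_eLpNorm_sub_lt hC hψ_meas hψ_nonconst (hf.2 i) hδ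
  choose G hG hGlt using happrox
  let g : TimeInterval u → Fin d → ℝ := fun t i => G i t
  have hg : g ∈ networkSubmodule u ψ d := mem_networkSubmodule_of_forall hG
  have hfg : f - g ∈ Lambda20 π μ := sub_mem hf (hsub hg)
  obtain ⟨hmem, hle⟩ := mem_Lambda2_and_integral_quadForm_le hπ hpos hfg
  refine ⟨g, hg, hmem, (Real.sqrt_lt' hε).2 (hle.trans_lt ?_)⟩
  have hsum : ∑ i, ∫ s, (f - g) s i ^ 2 ∂(diagMeasure π μ i) ≤ d * (ε / (d + 1)) ^ 2 := by
    refine (Finset.sum_le_sum fun i _ =>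
      (integral_sq_lt_of_eLpNorm_lt (hfg.2 i) hδ (hGlt i)).le).trans_eq ?_
    simp
  have hd : (d : ℝ) / (d + 1) < 1 := (div_lt_one (by positivity)).2 (by linarith)
  calc (d : ℝ) * ∑ i, ∫ s, (f - g) s i ^ 2 ∂(diagMeasure π μ i)
      ≤ d * (d * (ε / (d + 1)) ^ 2) := mul_le_mul_of_nonneg_left hsum (Nat.cast_nonneg d)
    _ = (d / (d + 1)) ^ 2 * ε ^ 2 := by ring
    _ < 1 * ε ^ 2 := by
        refine mul_lt_mul_of_pos_right ?_ (by positivity)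
        exact pow_lt_one₀ (by positivity) hd two_ne_zero
    _ = ε ^ 2 := one_mul _
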